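/- For every real number $M$ there is a constant $C>0$, depending only on $M$, such that the following holds. Let $n\ge 1$, let $\Omega\subset\mathbb{R}^n$ be open, and let $V:\mathbb{R}^n\to\mathbb{R}$ be a bounded continuous function with $0\le V(x)\le M$ for all $x\in\mathbb{R}^n$ and $V(x)>0$ for all $x\in\Omega$. All functions are real-valued, $\|\cdot\|$ is the norm of $L^2(\mathbb{R}^n)$, and $\nabla$ is the weak gradient. Let $u_0\in H^1(\mathbb{R}^n)$ and $u_1\in L^2(\mathbb{R}^n)$ satisfy $\operatorname{supp}(u_1+u_0)\subset\overline{\Omega}$ (where the support is the complement of the largest open set on which the function vanishes almost everywhere), $u_1+u_0=0$ almost everywhere on $\partial\Omega$ (which is automatic if $\partial\Omega$ is a null set), and $$L_0^2:=\int_\Omega\frac{|u_1(x)+u_0(x)|^2}{V(x)}\,dx<\infty .$$ Let $u\in C([0,\infty);H^1(\mathbb{R}^n))\cap C^1([0,\infty);L^2(\mathbb{R}^n))$ be the weak solution of $$u_{tt}-\Delta u+V(x)u+u_t=0\quad(t>0,\ x\in\mathbb{R}^n),\qquad u(0,\cdot)=u_0,\quad u_t(0,\cdot)=u_1,$$ that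 is, $u(0)=u_0$, $u_t(0)=u_1$ and, for all $\varphi\in H^1(\mathbb{R}^n)$ and all $t>0$, $$\frac{d}{dt}(u_t(t),\varphi)+(\nabla u(t),\nabla\varphi)+(Vu(t),\varphi)+(u_t(t),\varphi)=0,$$ where $(\cdot,\cdot)$ is the $L^2$ inner product. Put $$E(t):=\frac12\int_{\mathbb{R}^n}\bigl(|u_t(t,x)|^2+|\nabla u(t,x)|^2+V(x)|u(t,x)|^2\bigr)\,dx .$$ Then, for all $t\ge 0$, $$(1+t)^2E(t)\le C\bigl(\|u_0\|^2+\|u_1\|^2+\|\nabla u_0\|^2+L_0^2\bigr),$$ $$(1+t)\,\|u(t,\cdot)\|^2\le C\bigl(\|u_0\|^2+\|u_1\|^2+\|\nabla u_0\|^2+L_0^2\bigr).$$ -/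

import Mathlib

open MeasureTheory Set Topology
open scoped ContDiff BoundedContinuousFunction

noncomputable section

namespace DampedWave

/-- The space `ℝⁿ` with its Euclidean norm. -/
abbrev Space (n : ℕ) : Type := EuclideanSpace ℝ (Fin n)

/-- Real-valued `L²(ℝⁿ)`. -/
abbrev L2 (n : ℕ) : Type := Lp ℝ 2 (volume : Measure (Space n))

/-- `L²(ℝⁿ; ℝⁿ)`, the space of square integrable vector fields. -/
abbrev L2Vec (n : ℕ) : Type := Lp (Space n) 2 (volume : Measure (Space n))

/-- `g` is the weak gradient of `f`:
`∫ f ∂ᵢφ = - ∫ gᵢ φ` for all test functions `φ ∈ C_c^∞(ℝⁿ)` and all `i`. -/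
def IsWeakGradient {n : ℕ} (f : L2 n) (g : L2Vec n) : Prop :=
  ∀ φ : Space n → ℝ, ContDiff ℝ ∞ φ → HasCompactSupport φ → ∀ i : Fin n,
    ∫ x, f x * fderiv ℝ φ x (EuclideanSpace.single i 1) = - ∫ x, g x i * φ x

lemma integrable_coe_mul {n : ℕ} (f : L2 n) {ψ : Space n → ℝ} (hψ : Continuous ψ)
    (hc : HasCompactSupport ψ) : Integrable (fun x => f x * ψ x) :=
  (Lp.memLp f).integrable_mul (q := 2) (hψ.memLp_of_hasCompactSupport hc)

lemma integrable_coord_mul {n : ℕ} (g : L2Vec n) (i : Fin n) {ψ : Space n → ℝ}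
    (hψ : Continuous ψ) (hc : HasCompactSupport ψ) :
    Integrable (fun x => g x i * ψ x) := by
  have h : MemLp (fun x => g x i) 2 (volume : Measure (Space n)) :=
    (EuclideanSpace.proj (𝕜 := ℝ) i : Space n →L[ℝ] ℝ).comp_memLp' (Lp.memLp g)
  exact h.integrable_mul (q := 2) (hψ.memLp_of_hasCompactSupport hc)

lemma continuous_fderiv_apply {n : ℕ} {φ : Space n → ℝ} (hφ : ContDiff ℝ ∞ φ) (e : Space n) :
    Continuous (fun x => fderiv ℝ φ x e) :=
  (hφ.continuous_fderiv (by simp)).clm_apply continuous_const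

/-- The Sobolev space `H¹(ℝⁿ)`: the pairs `(f, ∇f)` of an `f ∈ L²(ℝⁿ)` and its weak gradient
`∇f ∈ L²(ℝⁿ; ℝⁿ)` (which is determined by `f`), with the norm `(‖f‖² + ‖∇f‖²)^{1/2}`. -/
def H1 (n : ℕ) : Submodule ℝ (WithLp 2 (L2 n × L2Vec n)) where
  carrier := {p | IsWeakGradient p.fst p.snd}
  zero_mem' := by
    intro φ hφ hc i
    have h1 : ∀ᵐ x : Space n, (0 : L2 n) x * fderiv ℝ φ x (EuclideanSpace.single i 1) = 0 := by
      filter_upwards [Lp.coeFn_zero ℝ 2 (volume : Measure (Space n))] with x hx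
      rw [hx]
      simp only [Pi.zero_apply, zero_mul]
    have h2 : ∀ᵐ x : Space n, (0 : L2Vec n) x i * φ x = 0 := by
      filter_upwards [Lp.coeFn_zero (Space n) 2 (volume : Measure (Space n))] with x hx
      rw [hx]
      simp only [Pi.zero_apply, PiLp.zero_apply, zero_mul]
    change ∫ x, (0 : L2 n) x * _ = - ∫ x, (0 : L2Vec n) x i * φ x
    rw [integral_eq_zero_of_ae h1, integral_eq_zero_of_ae h2, neg_zero]
  add_mem' := by
    intro p q hp hq φ hφ hc i
    have hd := continuous_fderiv_apply hφ (EuclideanSpace.single i (1 : ℝ))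
    have hdc : HasCompactSupport (fun x => fderiv ℝ φ x (EuclideanSpace.single i (1 : ℝ))) :=
      hc.fderiv_apply ℝ _
    have h1 : ∫ x, (p.fst + q.fst : L2 n) x * fderiv ℝ φ x (EuclideanSpace.single i 1)
        = ∫ x, (p.fst x * fderiv ℝ φ x (EuclideanSpace.single i 1)
          + q.fst x * fderiv ℝ φ x (EuclideanSpace.single i 1)) := by
      apply integral_congr_ae
      filter_upwards [Lp.coeFn_add p.fst q.fst] with x hx
      rw [hx]
      simp only [Pi.add_apply, add_mul]
    have h2 : ∫ x, (p.snd + q.snd : L2Vec n) x i * φ x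
        = ∫ x, (p.snd x i * φ x + q.snd x i * φ x) := by
      apply integral_congr_ae
      filter_upwards [Lp.coeFn_add p.snd q.snd] with x hx
      rw [hx]
      simp only [Pi.add_apply, PiLp.add_apply, add_mul]
    change ∫ x, (p.fst + q.fst : L2 n) x * _ = - ∫ x, (p.snd + q.snd : L2Vec n) x i * φ x
    rw [h1, h2, integral_add (integrable_coe_mul _ hd hdc) (integrable_coe_mul _ hd hdc),
      integral_add (integrable_coord_mul _ i hφ.continuous hc)
        (integrable_coord_mul _ i hφ.continuous hc), hp φ hφ hc i, hq φ hφ hc i]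
    ring
  smul_mem' := by
    intro c p hp φ hφ hc i
    have h1 : ∫ x, (c • p.fst : L2 n) x * fderiv ℝ φ x (EuclideanSpace.single i 1)
        = ∫ x, c * (p.fst x * fderiv ℝ φ x (EuclideanSpace.single i 1)) := by
      apply integral_congr_ae
      filter_upwards [Lp.coeFn_smul c p.fst] with x hx
      rw [hx]
      simp only [Pi.smul_apply, smul_eq_mul, mul_assoc]
    have h2 : ∫ x, (c • p.snd : L2Vec n) x i * φ x = ∫ x, c * (p.snd x i * φ x) := by
      apply integral_congr_ae
      filter_upwards [Lp.coeFn_smul c p.snd] with x hx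
      rw [hx]
      simp only [Pi.smul_apply, PiLp.smul_apply, smul_eq_mul, mul_assoc]
    change ∫ x, (c • p.fst : L2 n) x * _ = - ∫ x, (c • p.snd : L2Vec n) x i * φ x
    rw [h1, h2, integral_const_mul, integral_const_mul, hp φ hφ hc i]
    ring

/-- The function `f ∈ L²(ℝⁿ)` underlying an element of `H¹(ℝⁿ)`. -/
def toL2 {n : ℕ} (f : H1 n) : L2 n := f.1.fst

/-- The weak gradient `∇f ∈ L²(ℝⁿ; ℝⁿ)` of an element `f` of `H¹(ℝⁿ)`. -/
def grad {n : ℕ} (f : H1 n) : L2Vec n := f.1.snd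

/-- The time derivative `u_t(t) ∈ L²(ℝⁿ)` of `u : [0,∞) → L²(ℝⁿ)` (one-sided at `t = 0`).
The values of `u` at negative times play no role. -/
def timeDeriv {n : ℕ} (u : ℝ → H1 n) (t : ℝ) : L2 n :=
  derivWithin (fun s => toL2 (u s)) (Ici 0) t

/-- `u` is a weak solution, in the class `C([0,∞); H¹(ℝⁿ)) ∩ C¹([0,∞); L²(ℝⁿ))`, of
`u_tt - Δu + V u + u_t = 0`, `u(0) = u₀`, `u_t(0) = u₁`. The equation is tested with
`φ ∈ H¹(ℝⁿ)`: for every `t > 0`,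
`d/dt (u_t(t), φ) + (∇u(t), ∇φ) + (V u(t), φ) + (u_t(t), φ) = 0`. -/
structure IsWeakSolution {n : ℕ} (V : Space n →ᵇ ℝ) (u₀ : H1 n) (u₁ : L2 n)
    (u : ℝ → H1 n) : Prop where
  continuousOn : ContinuousOn u (Ici 0)
  contDiffOn : ContDiffOn ℝ 1 (fun t => toL2 (u t)) (Ici 0)
  initial : u 0 = u₀
  initial_deriv : timeDeriv u 0 = u₁
  equation : ∀ φ : H1 n, ∀ t : ℝ, 0 < t →
    HasDerivAt (fun s => inner ℝ (timeDeriv u s) (toL2 φ))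
      (-(inner ℝ (grad (u t)) (grad φ) + (∫ x, V x * toL2 (u t) x * toL2 φ x)
        + inner ℝ (timeDeriv u t) (toL2 φ))) t

/-- The total energy `E(t) = ½ ∫ (|u_t|² + |∇u|² + V |u|²) dx`. -/
def energy {n : ℕ} (V : Space n →ᵇ ℝ) (u : ℝ → H1 n) (t : ℝ) : ℝ :=
  1 / 2 * ∫ x, (|timeDeriv u t x| ^ 2 + ‖grad (u t) x‖ ^ 2 + V x * |toL2 (u t) x| ^ 2)

/-- The support of a class `f ∈ L²(ℝⁿ)`: the complement of the largest open set on which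
`f = 0` almost everywhere. -/
def essSupport {n : ℕ} (f : L2 n) : Set (Space n) :=
  {x | ∀ U : Set (Space n), IsOpen U → x ∈ U → ¬ ∀ᵐ y : Space n, y ∈ U → f y = 0}

end DampedWave

end

/-! Let `A = -Δ + V`, let `E` be the energy and `P = (u_t, u) + ‖u‖² / 2`, so that `E' = -‖u_t‖²`
and `P' = ‖u_t‖² - (A u, u)`. A weak solution is too irregular for the energy to be differentiated
directly, so the first identity is proved for the Steklov averages of `u`, which are strong
solutions, and passes to the limit in its integrated form.

The primitive `v(t) = ∫₀ᵗ u` solves the same equation with the constant right-hand side `u₁ + u₀`.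
Its energy `F`, which includes the term `-(u₁ + u₀, v)`, satisfies `F' = -‖u‖²`, and it is bounded
below because `(u₁ + u₀, v) ≤ ½ ∫ |u₁ + u₀|² / V + ½ ∫ V |v|²`. In
`L = ((2 + t)² + 1) E + (2 + t) P + F` the weights are chosen so that the potential energy drops out
of the derivative: `L' = P - (1 + t)² ‖u_t‖² - ‖u‖² ≤ 0`. The bound `L(t) ≤ L(0)` contains both
estimates. -/

noncomputable section

namespace DampedWave

section SteklovAverage

variable {E : Type*} [NormedAddCommGroup E] [NormedSpace ℝ E]

/-- The Steklov average `r⁻¹ ∫_s^{s+r} g` of `g`, written as an integral over `[0, 1]` so that it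
is meaningful, and equal to `g s`, at `r = 0`. -/
def steklovAverage (g : ℝ → E) (r s : ℝ) : E :=
  ∫ θ in (0 : ℝ)..1, g (s + r * θ)

variable {g g' : ℝ → E} {r s : ℝ}

@[fun_prop]
lemma continuous_steklovAverage {T : Type*} [TopologicalSpace T] {r s : T → ℝ}
    (hg : Continuous g) (hr : Continuous r) (hs : Continuous s) :
    Continuous fun x => steklovAverage g (r x) (s x) := by
  unfold steklovAverage
  fun_prop

lemma steklovAverage_eq_smul_integral (g : ℝ → E) (hr : r ≠ 0) (s : ℝ) :
    steklovAverage g r s = r⁻¹ • ∫ σ in s..(s + r), g σ := by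
  rw [steklovAverage, intervalIntegral.integral_comp_add_mul g hr, mul_zero, mul_one, add_zero]

variable [CompleteSpace E]

lemma steklovAverage_zero (g : ℝ → E) (s : ℝ) : steklovAverage g 0 s = g s := by
  simp [steklovAverage]

lemma hasDerivAt_integral (hg : Continuous g) (s : ℝ) :
    HasDerivAt (fun s => ∫ σ in (0 : ℝ)..s, g σ) (g s) s :=
  (hg.integral_hasStrictDerivAt 0 s).hasDerivAt

lemma hasDerivAt_steklovAverage (hg : Continuous g) (hr : r ≠ 0) (s : ℝ) :
    HasDerivAt (steklovAverage g r) (r⁻¹ • (g (s + r) - g s)) s := by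
  have hprim : steklovAverage g r =
      fun s => r⁻¹ • ((∫ σ in (0 : ℝ)..(s + r), g σ) - ∫ σ in (0 : ℝ)..s, g σ) := by
    funext s
    rw [steklovAverage_eq_smul_integral g hr, intervalIntegral.integral_interval_sub_left
      (hg.intervalIntegrable _ _) (hg.intervalIntegrable _ _)]
  rw [hprim]
  exact (((hasDerivAt_integral hg (s + r)).comp_add_const s r).sub
    (hasDerivAt_integral hg s)).const_smul r⁻¹

lemma steklovAverage_deriv (hg' : Continuous g') (hr : 0 < r)
    (hd : ∀ σ ∈ Icc s (s + r), HasDerivAt g (g' σ) σ) :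
    steklovAverage g' r s = r⁻¹ • (g (s + r) - g s) := by
  rw [steklovAverage_eq_smul_integral g' hr.ne',
    intervalIntegral.integral_eq_sub_of_hasDerivAt _ (hg'.intervalIntegrable _ _)]
  rwa [uIcc_of_le (by linarith)]

end SteklovAverage

section AbstractEquation

variable {X H : Type*} [NormedAddCommGroup X] [NormedSpace ℝ X]
  [NormedAddCommGroup H]
  {a : X →L[ℝ] X →L[ℝ] ℝ}

/-- The energy `(‖y‖² + a(x, x)) / 2` of the position `x` and the velocity `y`. -/
def phaseEnergy (a : X →L[ℝ] X →L[ℝ] ℝ) (x : X) (y : H) : ℝ :=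
  (‖y‖ ^ 2 + a x x) / 2

@[fun_prop]
lemma continuous_phaseEnergy {T : Type*} [TopologicalSpace T] {x : T → X} {y : T → H}
    (hx : Continuous x) (hy : Continuous y) : Continuous fun s => phaseEnergy a (x s) (y s) := by
  unfold phaseEnergy
  fun_prop

variable [InnerProductSpace ℝ H]

/-- The quantity `⟪y, x⟫ + ‖x‖² / 2` of the position `x` and the velocity `y`, whose time
derivative `‖y‖² - a(x, x)` produces the potential energy. -/
def virial (j : X →L[ℝ] H) (x : X) (y : H) : ℝ :=
  inner ℝ y (j x) + ‖j x‖ ^ 2 / 2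

/-- `u` has velocity `w` and solves `u'' + A u + u' = 0` weakly on `(0, ∞)`, where `A` is the
operator of the form `a` on `X` and `j` embeds `X` into `H`. Continuity is required on all of `ℝ`:
a solution on `[0, ∞)` is extended to negative times by its value at `0`. -/
structure IsDampedSolution (j : X →L[ℝ] H) (a : X →L[ℝ] X →L[ℝ] ℝ) (u : ℝ → X)
    (w : ℝ → H) : Prop where
  continuous : Continuous u
  continuous_velocity : Continuous w
  hasDerivAt : ∀ t, 0 < t → HasDerivAt (fun s => j (u s)) (w t) t
  equation : ∀ φ t, 0 < t →
    HasDerivAt (fun s => inner ℝ (w s) (j φ)) (-(a (u t) φ + inner ℝ (w t) (j φ))) t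

/-- The energy of the primitive `∫₀ᵗ u`, which solves the damped equation with the constant
right-hand side `w 0 + j (u 0)`; its velocity is `j (u t)`. -/
def primitiveEnergy (j : X →L[ℝ] H) (a : X →L[ℝ] X →L[ℝ] ℝ) (u : ℝ → X) (w : ℝ → H) (t : ℝ) :
    ℝ :=
  phaseEnergy a (∫ s in (0 : ℝ)..t, u s) (j (u t))
    - inner ℝ (w 0 + j (u 0)) (j (∫ s in (0 : ℝ)..t, u s))

/-- The Lyapunov functional `((2 + t)² + 1) E + (2 + t) P + F` of a damped solution, with `E` the
energy, `P` the virial quantity and `F` the energy of the primitive. -/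
def lyapunov (j : X →L[ℝ] H) (a : X →L[ℝ] X →L[ℝ] ℝ) (u : ℝ → X) (w : ℝ → H) (t : ℝ) : ℝ :=
  ((2 + t) ^ 2 + 1) * phaseEnergy a (u t) (w t) + (2 + t) * virial j (u t) (w t)
    + primitiveEnergy j a u w t

variable {j : X →L[ℝ] H}

lemma virial_le (x : X) (y : H) : virial j x y ≤ ‖y‖ ^ 2 / 2 + ‖j x‖ ^ 2 := by
  have hcs := real_inner_le_norm y (j x)
  have hsq := two_mul_le_add_sq ‖y‖ ‖j x‖
  unfold virial
  linarith

lemma le_virial (x : X) (y : H) : ‖j x‖ ^ 2 / 4 - ‖y‖ ^ 2 ≤ virial j x y := by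
  have hcs := neg_le_of_abs_le (abs_real_inner_le_norm y (j x))
  have hsq := two_mul_le_add_sq ‖y‖ (‖j x‖ / 2)
  unfold virial
  linarith

@[fun_prop]
lemma continuous_virial {T : Type*} [TopologicalSpace T] {x : T → X} {y : T → H}
    (hx : Continuous x) (hy : Continuous y) : Continuous fun s => virial j (x s) (y s) := by
  unfold virial
  fun_prop

lemma hasDerivAt_inner_of_eq_zero {f g : ℝ → H} {g' : H} {t : ℝ} (hf : ContinuousAt f t)
    (hg : HasDerivAt g g' t) (hgt : g t = 0) :
    HasDerivAt (fun s => inner ℝ (f s) (g s)) (inner ℝ (f t) g') t := by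
  rw [hasDerivAt_iff_tendsto_slope] at hg ⊢
  refine ((hf.mono_left nhdsWithin_le_nhds).inner hg).congr fun s => ?_
  simp only [slope_def_module, hgt, sub_zero, inner_zero_right, inner_smul_right, smul_eq_mul]

lemma hasDerivAt_phaseEnergy (hsymm : ∀ x y, a x y = a y x) {z : ℝ → X} {y : ℝ → H} {z' : X}
    {y' : H} {t : ℝ} (hz : HasDerivAt z z' t) (hy : HasDerivAt y y' t) :
    HasDerivAt (fun s => phaseEnergy a (z s) (y s)) (inner ℝ (y t) y' + a (z t) z') t := by
  have hform : HasDerivAt (fun s => a (z s) (z s)) (a (z t) z' + a z' (z t)) t :=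
    a.hasDerivAt_of_bilinear (fun _ => hz) (fun _ => hz)
  refine ((hy.norm_sq.add hform).div_const 2).congr_deriv ?_
  rw [hsymm z']
  ring

variable {u : ℝ → X} {w : ℝ → H}

lemma le_lyapunov (hnonneg : ∀ x, 0 ≤ a x x) {K : ℝ}
    (hK : ∀ φ, inner ℝ (w 0 + j (u 0)) (j φ) ≤ a φ φ / 2 + K) {t : ℝ} (ht : 0 ≤ t) :
    (1 + t) ^ 2 * phaseEnergy a (u t) (w t) + (1 + t) * ‖j (u t)‖ ^ 2 / 4
      ≤ lyapunov j a u w t + K := by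
  have hvirial := mul_le_mul_of_nonneg_left (le_virial (j := j) (u t) (w t))
    (by linarith : 0 ≤ 2 + t)
  have hform : 0 ≤ (4 + 2 * t) * a (u t) (u t) := mul_nonneg (by linarith) (hnonneg _)
  have hprim := hK (∫ s in (0 : ℝ)..t, u s)
  unfold lyapunov primitiveEnergy phaseEnergy
  linarith [sq_nonneg ‖j (u t)‖]

lemma lyapunov_zero_le :
    lyapunov j a u w 0 ≤ 7 / 2 * ‖w 0‖ ^ 2 + 5 / 2 * a (u 0) (u 0) + 5 / 2 * ‖j (u 0)‖ ^ 2 := by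
  have hvirial := virial_le (j := j) (u 0) (w 0)
  simp only [lyapunov, primitiveEnergy, phaseEnergy, intervalIntegral.integral_same, map_zero,
    inner_zero_right]
  linarith

namespace IsDampedSolution

variable {r t : ℝ}

lemma hasDerivAt_virial (h : IsDampedSolution j a u w) (ht : 0 < t) :
    HasDerivAt (fun s => virial j (u s) (w s)) (‖w t‖ ^ 2 - a (u t) (u t)) t := by
  -- Only the pairings of `w` with fixed elements of `X` are differentiable, so the product rule
  -- for `⟪w, j u⟫` is applied with `u t` frozen.
  have hfrozen := h.equation (u t) t ht
  have hmoving := hasDerivAt_inner_of_eq_zero h.continuous_velocity.continuousAt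
    ((h.hasDerivAt t ht).sub_const (j (u t))) (sub_self _)
  have hsplit : (fun s => virial j (u s) (w s)) = fun s =>
      inner ℝ (w s) (j (u t)) + inner ℝ (w s) (j (u s) - j (u t)) + ‖j (u s)‖ ^ 2 / 2 := by
    funext s
    rw [← inner_add_right, add_sub_cancel, virial]
  rw [hsplit]
  refine ((hfrozen.add hmoving).add ((h.hasDerivAt t ht).norm_sq.div_const 2)).congr_deriv ?_
  rw [real_inner_self_eq_norm_sq, real_inner_comm]
  ring

lemma continuous_primitiveEnergy (h : IsDampedSolution j a u w) :
    Continuous (primitiveEnergy j a u w) := by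
  have hu := h.continuous
  unfold primitiveEnergy
  fun_prop

variable [CompleteSpace X]

lemma integrated_equation (h : IsDampedSolution j a u w) (φ : X) {s : ℝ} (hs : 0 ≤ s)
    (hst : s ≤ t) :
    inner ℝ (w t + j (u t)) (j φ) + a (∫ σ in s..t, u σ) φ = inner ℝ (w s + j (u s)) (j φ) := by
  have hu := h.continuous
  have hw := h.continuous_velocity
  have hderiv : ∀ σ ∈ Ioo s t,
      HasDerivAt (fun σ => inner ℝ (w σ + j (u σ)) (j φ)) (-a (u σ) φ) σ := by
    intro σ hσ
    have hσ0 : 0 < σ := hs.trans_lt hσ.1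
    simp only [inner_add_left]
    refine ((h.equation φ σ hσ0).add
      ((h.hasDerivAt σ hσ0).inner ℝ (hasDerivAt_const σ (j φ)))).congr_deriv ?_
    rw [inner_zero_right]
    ring
  have hftc := intervalIntegral.integral_eq_sub_of_hasDerivAt_of_le hst (by fun_prop) hderiv
    (Continuous.intervalIntegrable (by fun_prop) _ _)
  have hform : ∫ σ in s..t, a (u σ) φ = a (∫ σ in s..t, u σ) φ :=
    (a.flip φ).intervalIntegral_comp_comm (hu.intervalIntegrable s t)
  rw [intervalIntegral.integral_neg, hform] at hftc
  linarith

lemma hasDerivAt_primitiveEnergy (h : IsDampedSolution j a u w) (hsymm : ∀ x y, a x y = a y x)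
    (ht : 0 < t) : HasDerivAt (primitiveEnergy j a u w) (-‖j (u t)‖ ^ 2) t := by
  have hprim := hasDerivAt_integral h.continuous t
  have hforcing := (hasDerivAt_const t (w 0 + j (u 0))).inner ℝ
    (j.hasFDerivAt.comp_hasDerivAt t hprim)
  refine ((hasDerivAt_phaseEnergy hsymm hprim (h.hasDerivAt t ht)).sub hforcing).congr_deriv ?_
  have heq := h.integrated_equation (u t) le_rfl ht.le
  rw [inner_add_left (w t), real_inner_self_eq_norm_sq] at heq
  rw [inner_zero_left, real_inner_comm]
  linarith

lemma steklovAverage_equation (h : IsDampedSolution j a u w) (φ : X) (hr : 0 < r) (ht : 0 ≤ t) :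
    inner ℝ (r⁻¹ • (w (t + r) - w t) + j (r⁻¹ • (u (t + r) - u t))) (j φ)
      + a (steklovAverage u r t) φ = 0 := by
  have heq := h.integrated_equation φ ht (le_add_of_nonneg_right hr.le)
  have hincrement : r⁻¹ • (w (t + r) - w t) + j (r⁻¹ • (u (t + r) - u t))
      = r⁻¹ • (w (t + r) + j (u (t + r)) - (w t + j (u t))) := by
    rw [map_smul, map_sub]
    module
  rw [hincrement, steklovAverage_eq_smul_integral u hr.ne', map_smul, inner_smul_left,
    inner_sub_left, conj_trivial, smul_apply, smul_eq_mul, ← mul_add]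
  exact mul_eq_zero_of_right _ (by linarith)

variable [CompleteSpace H]

lemma hasDerivAt_phaseEnergy_steklovAverage (h : IsDampedSolution j a u w)
    (hsymm : ∀ x y, a x y = a y x) (hr : 0 < r) (ht : 0 < t) :
    HasDerivAt (fun s => phaseEnergy a (steklovAverage u r s) (steklovAverage w r s))
      (-‖steklovAverage w r t‖ ^ 2) t := by
  have hvelocity : steklovAverage w r t = j (r⁻¹ • (u (t + r) - u t)) := by
    rw [steklovAverage_deriv h.continuous_velocity hr
      fun σ hσ => h.hasDerivAt σ (ht.trans_le hσ.1), map_smul, map_sub]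
  have heq := h.steklovAverage_equation (r⁻¹ • (u (t + r) - u t)) hr ht.le
  rw [← hvelocity, inner_add_left, real_inner_self_eq_norm_sq] at heq
  refine (hasDerivAt_phaseEnergy hsymm (hasDerivAt_steklovAverage h.continuous hr.ne' t)
    (hasDerivAt_steklovAverage h.continuous_velocity hr.ne' t)).congr_deriv ?_
  rw [real_inner_comm]
  linarith

lemma phaseEnergy_steklovAverage_add_integral (h : IsDampedSolution j a u w)
    (hsymm : ∀ x y, a x y = a y x) (hr : 0 < r) (ht : 0 ≤ t) :
    phaseEnergy a (steklovAverage u r t) (steklovAverage w r t)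
        + ∫ s in (0 : ℝ)..t, ‖steklovAverage w r s‖ ^ 2
      = phaseEnergy a (steklovAverage u r 0) (steklovAverage w r 0) := by
  have hu := h.continuous
  have hw := h.continuous_velocity
  have hftc := intervalIntegral.integral_eq_sub_of_hasDerivAt_of_le ht (by fun_prop)
    (fun s hs => h.hasDerivAt_phaseEnergy_steklovAverage hsymm hr hs.1)
    (Continuous.intervalIntegrable (by fun_prop) _ _)
  rw [intervalIntegral.integral_neg] at hftc
  linarith

theorem phaseEnergy_add_integral (h : IsDampedSolution j a u w) (hsymm : ∀ x y, a x y = a y x)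
    (ht : 0 ≤ t) :
    phaseEnergy a (u t) (w t) + ∫ s in (0 : ℝ)..t, ‖w s‖ ^ 2 = phaseEnergy a (u 0) (w 0) := by
  have hu := h.continuous
  have hw := h.continuous_velocity
  have hclosed : IsClosed {r : ℝ | phaseEnergy a (steklovAverage u r t) (steklovAverage w r t)
        + ∫ s in (0 : ℝ)..t, ‖steklovAverage w r s‖ ^ 2
      = phaseEnergy a (steklovAverage u r 0) (steklovAverage w r 0)} :=
    isClosed_eq (by fun_prop) (by fun_prop)
  have hlimit := hclosed.closure_subset_iff.2
    (fun r hr => h.phaseEnergy_steklovAverage_add_integral hsymm hr ht)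
    (closure_Ioi (0 : ℝ) ▸ self_mem_Ici)
  simpa only [mem_ofPred_eq, steklovAverage_zero] using hlimit

lemma hasDerivAt_phaseEnergy (h : IsDampedSolution j a u w) (hsymm : ∀ x y, a x y = a y x)
    (ht : 0 < t) : HasDerivAt (fun s => phaseEnergy a (u s) (w s)) (-‖w t‖ ^ 2) t := by
  have hdissipation : Continuous fun s => ‖w s‖ ^ 2 := h.continuous_velocity.norm.pow 2
  refine ((hasDerivAt_integral hdissipation t).const_sub
    (phaseEnergy a (u 0) (w 0))).congr_of_eventuallyEq ?_
  filter_upwards [Ioi_mem_nhds ht] with s hs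
  exact eq_sub_of_add_eq (h.phaseEnergy_add_integral hsymm (le_of_lt hs))

lemma hasDerivAt_lyapunov (h : IsDampedSolution j a u w) (hsymm : ∀ x y, a x y = a y x)
    (ht : 0 < t) :
    HasDerivAt (lyapunov j a u w)
      (virial j (u t) (w t) - (1 + t) ^ 2 * ‖w t‖ ^ 2 - ‖j (u t)‖ ^ 2) t := by
  have hshift : HasDerivAt (fun s : ℝ => 2 + s) 1 t := (hasDerivAt_id t).const_add 2
  have hweight : HasDerivAt (fun s : ℝ => (2 + s) ^ 2 + 1) (2 * (2 + t)) t :=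
    ((hshift.fun_pow 2).add_const 1).congr_deriv (by ring)
  refine (((hweight.mul (h.hasDerivAt_phaseEnergy hsymm ht)).add
    (hshift.mul (h.hasDerivAt_virial ht))).add
      (h.hasDerivAt_primitiveEnergy hsymm ht)).congr_deriv ?_
  rw [phaseEnergy]
  ring

lemma antitoneOn_lyapunov (h : IsDampedSolution j a u w) (hsymm : ∀ x y, a x y = a y x) :
    AntitoneOn (lyapunov j a u w) (Ici 0) := by
  have hu := h.continuous
  have hw := h.continuous_velocity
  have hprim := h.continuous_primitiveEnergy
  have hcont : Continuous (lyapunov j a u w) := by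
    unfold lyapunov
    fun_prop
  refine antitoneOn_of_hasDerivWithinAt_nonpos (convex_Ici 0) hcont.continuousOn
    (fun t ht => (h.hasDerivAt_lyapunov hsymm (interior_Ici.subset ht)).hasDerivWithinAt)
    fun t ht => ?_
  have ht0 : 0 < t := interior_Ici.subset ht
  have hvirial := virial_le (j := j) (u t) (w t)
  have hweight : ‖w t‖ ^ 2 ≤ (1 + t) ^ 2 * ‖w t‖ ^ 2 :=
    le_mul_of_one_le_left (sq_nonneg _) (by nlinarith)
  linarith [sq_nonneg ‖w t‖]

theorem decay (h : IsDampedSolution j a u w) (hsymm : ∀ x y, a x y = a y x)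
    (hnonneg : ∀ x, 0 ≤ a x x) {K : ℝ}
    (hK : ∀ φ, inner ℝ (w 0 + j (u 0)) (j φ) ≤ a φ φ / 2 + K) (ht : 0 ≤ t) :
    (1 + t) ^ 2 * phaseEnergy a (u t) (w t) + (1 + t) * ‖j (u t)‖ ^ 2 / 4
      ≤ 7 / 2 * ‖w 0‖ ^ 2 + 5 / 2 * a (u 0) (u 0) + 5 / 2 * ‖j (u 0)‖ ^ 2 + K :=
  (le_lyapunov hnonneg hK ht).trans <| add_le_add_left
    ((h.antitoneOn_lyapunov hsymm self_mem_Ici ht ht).trans lyapunov_zero_le) K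

end IsDampedSolution

end AbstractEquation

section SquareIntegrable

variable {α : Type*} [MeasurableSpace α] {μ : Measure α} {E : Type*} [NormedAddCommGroup E]

lemma continuous_integral_clm_mul [NormedSpace ℝ E] (L : E →L[ℝ] ℝ) {ψ : α → ℝ}
    (hψ : MemLp ψ 2 μ) : Continuous fun f : Lp E 2 μ => ∫ x, L (f x) * ψ x ∂μ := by
  have hpairing : (fun f : Lp E 2 μ => ∫ x, L (f x) * ψ x ∂μ) =
      (((ContinuousLinearMap.mul ℝ ℝ).comp L).lpPairing μ 2 2).flip hψ.toLp := by
    funext f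
    rw [ContinuousLinearMap.flip_apply, ContinuousLinearMap.lpPairing_eq_integral]
    refine integral_congr_ae ?_
    filter_upwards [hψ.coeFn_toLp] with x hx
    rw [hx, ContinuousLinearMap.comp_apply, ContinuousLinearMap.mul_apply']
  rw [hpairing]
  exact ContinuousLinearMap.continuous _

lemma integrable_norm_sq (f : Lp E 2 μ) : Integrable (fun x => ‖f x‖ ^ 2) μ :=
  (memLp_two_iff_integrable_sq_norm (Lp.aestronglyMeasurable f)).1 (Lp.memLp f)

lemma integral_norm_sq [InnerProductSpace ℝ E] (f : Lp E 2 μ) : ∫ x, ‖f x‖ ^ 2 ∂μ = ‖f‖ ^ 2 := by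
  simp only [← real_inner_self_eq_norm_sq, L2.inner_def]

lemma inner_eq_integral_mul (f g : Lp ℝ 2 μ) : inner ℝ f g = ∫ x, f x * g x ∂μ := by
  simp only [L2.inner_def, RCLike.inner_apply, conj_trivial, mul_comm]

lemma mul_le_sq_div_add_mul_sq {f g v : ℝ} (hv : 0 ≤ v) (hzero : v = 0 → f = 0) :
    f * g ≤ (|f| ^ 2 / v + v * |g| ^ 2) / 2 := by
  rcases hv.eq_or_lt with rfl | hpos
  · simp [hzero rfl]
  · have hsquare : 0 ≤ (f - v * g) ^ 2 / v := by positivity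
    have hexpand : (f - v * g) ^ 2 / v = |f| ^ 2 / v + v * |g| ^ 2 - 2 * (f * g) := by
      rw [sq_abs, sq_abs]
      field_simp
      ring
    linarith

lemma inner_le_integral_sq_div_add {v : α → ℝ} {f g : Lp ℝ 2 μ} (hv : ∀ x, 0 ≤ v x)
    (hzero : ∀ᵐ x ∂μ, v x = 0 → f x = 0) (hf : Integrable (fun x => |f x| ^ 2 / v x) μ)
    (hg : Integrable (fun x => v x * |g x| ^ 2) μ) :
    inner ℝ f g ≤ ((∫ x, |f x| ^ 2 / v x ∂μ) + ∫ x, v x * |g x| ^ 2 ∂μ) / 2 := by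
  rw [inner_eq_integral_mul, ← integral_add hf hg, ← integral_div]
  refine integral_mono_ae ((Lp.memLp f).integrable_mul (Lp.memLp g)) ((hf.add hg).div_const 2) ?_
  filter_upwards [hzero] with x hx
  exact mul_le_sq_div_add_mul_sq (hv x) hx

end SquareIntegrable

section Sobolev

variable {n : ℕ}

lemma isClosed_H1 (n : ℕ) : IsClosed (H1 n : Set (WithLp 2 (L2 n × L2Vec n))) := by
  have htested : (H1 n : Set (WithLp 2 (L2 n × L2Vec n))) = ⋂ (φ : Space n → ℝ)
      (_ : ContDiff ℝ ∞ φ) (_ : HasCompactSupport φ) (i : Fin n),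
      {p | ∫ x, p.fst x * fderiv ℝ φ x (EuclideanSpace.single i 1)
        = - ∫ x, p.snd x i * φ x} := by
    ext p
    simp only [mem_iInter]
    rfl
  rw [htested]
  refine isClosed_iInter fun φ => isClosed_iInter fun hφ => isClosed_iInter fun hc =>
    isClosed_iInter fun i => isClosed_eq ?_ ?_
  · have hderiv : MemLp (fun x => fderiv ℝ φ x (EuclideanSpace.single i 1)) 2 volume :=
      (continuous_fderiv_apply hφ _).memLp_of_hasCompactSupport (hc.fderiv_apply ℝ _)
    exact (continuous_integral_clm_mul (.id ℝ ℝ) hderiv).comp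
      (WithLp.fstL 2 ℝ (L2 n) (L2Vec n)).continuous
  · have htest : MemLp φ 2 volume := hφ.continuous.memLp_of_hasCompactSupport hc
    exact ((continuous_integral_clm_mul (EuclideanSpace.proj i) htest).comp
      (WithLp.sndL 2 ℝ (L2 n) (L2Vec n)).continuous).neg

instance (n : ℕ) : CompleteSpace (H1 n) := (isClosed_H1 n).completeSpace_coe

/-- The inclusion of `H¹` into `L²` as a continuous linear map. -/
def toL2L (n : ℕ) : H1 n →L[ℝ] L2 n := (WithLp.fstL 2 ℝ (L2 n) (L2Vec n)).comp (H1 n).subtypeL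

/-- The weak gradient as a continuous linear map. -/
def gradL (n : ℕ) : H1 n →L[ℝ] L2Vec n := (WithLp.sndL 2 ℝ (L2 n) (L2Vec n)).comp (H1 n).subtypeL

@[simp] lemma toL2L_apply (f : H1 n) : toL2L n f = toL2 f := rfl

lemma memLp_top (V : Space n →ᵇ ℝ) : MemLp V ⊤ (volume : Measure (Space n)) :=
  memLp_top_of_bound V.continuous.aestronglyMeasurable ‖V‖ (.of_forall V.norm_coe_le_norm)

/-- Multiplication by the potential `V` on `L²`. -/
def potential (V : Space n →ᵇ ℝ) : L2 n →L[ℝ] L2 n :=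
  (ContinuousLinearMap.mul ℝ ℝ).holderL volume ⊤ 2 2 (memLp_top V).toLp

lemma coeFn_potential (V : Space n →ᵇ ℝ) (f : L2 n) :
    potential V f =ᵐ[volume] fun x => V x * f x := by
  filter_upwards [(ContinuousLinearMap.mul ℝ ℝ).coeFn_holder (r := 2) (memLp_top V).toLp f,
    (memLp_top V).coeFn_toLp] with x hx hV
  rw [← hV]
  exact hx

lemma inner_potential (V : Space n →ᵇ ℝ) (f g : L2 n) :
    inner ℝ (potential V f) g = ∫ x, V x * f x * g x := by
  rw [inner_eq_integral_mul]
  refine integral_congr_ae ?_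
  filter_upwards [coeFn_potential V f] with x hx
  rw [hx]

lemma integrable_potential_mul_sq (V : Space n →ᵇ ℝ) (f : L2 n) :
    Integrable (fun x => V x * |f x| ^ 2) := by
  simpa only [Real.norm_eq_abs] using
    (integrable_norm_sq f).bdd_mul V.continuous.aestronglyMeasurable
      (.of_forall V.norm_coe_le_norm)

/-- The bilinear form `∫ (∇f · ∇g + V f g) dx` on `H¹`, which is that of the operator `-Δ + V`. -/
def form (V : Space n →ᵇ ℝ) : H1 n →L[ℝ] H1 n →L[ℝ] ℝ :=
  (innerSL ℝ).bilinearComp (gradL n) (gradL n)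
    + (innerSL ℝ).bilinearComp ((potential V).comp (toL2L n)) (toL2L n)

lemma form_apply (V : Space n →ᵇ ℝ) (f g : H1 n) :
    form V f g = inner ℝ (grad f) (grad g) + ∫ x, V x * toL2 f x * toL2 g x := by
  rw [← inner_potential]
  rfl

lemma form_symm (V : Space n →ᵇ ℝ) (f g : H1 n) : form V f g = form V g f := by
  simp only [form_apply, real_inner_comm, mul_right_comm]

lemma form_self (V : Space n →ᵇ ℝ) (f : H1 n) :
    form V f f = ‖grad f‖ ^ 2 + ∫ x, V x * |toL2 f x| ^ 2 := by
  simp only [form_apply, real_inner_self_eq_norm_sq, sq_abs, pow_two (toL2 f _), mul_assoc]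

lemma form_self_nonneg {V : Space n →ᵇ ℝ} (hV : ∀ x, 0 ≤ V x) (f : H1 n) : 0 ≤ form V f f := by
  have hpotential : 0 ≤ ∫ x, V x * |toL2 f x| ^ 2 :=
    integral_nonneg fun x => mul_nonneg (hV x) (sq_nonneg _)
  rw [form_self]
  positivity

lemma form_self_le {V : Space n →ᵇ ℝ} {M : ℝ} (hVM : ∀ x, V x ≤ M) (f : H1 n) :
    form V f f ≤ ‖grad f‖ ^ 2 + M * ‖toL2 f‖ ^ 2 := by
  rw [form_self, ← integral_norm_sq (toL2 f), ← integral_const_mul]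
  gcongr
  · exact integrable_potential_mul_sq V _
  · exact (integrable_norm_sq (toL2 f)).const_mul M
  · intro x
    exact mul_le_mul_of_nonneg_right (hVM x) (sq_nonneg _)

lemma inner_toL2_le {V : Space n →ᵇ ℝ} (hV : ∀ x, 0 ≤ V x) {f : L2 n}
    (hzero : ∀ᵐ x : Space n, V x = 0 → f x = 0) (hf : Integrable fun x => |f x| ^ 2 / V x)
    (g : H1 n) :
    inner ℝ f (toL2 g) ≤ form V g g / 2 + (∫ x, |f x| ^ 2 / V x) / 2 := by
  have hyoung := inner_le_integral_sq_div_add hV hzero hf (integrable_potential_mul_sq V (toL2 g))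
  rw [form_self]
  linarith [sq_nonneg ‖grad g‖]

lemma energy_eq_phaseEnergy (V : Space n →ᵇ ℝ) (u : ℝ → H1 n) (t : ℝ) :
    energy V u t = phaseEnergy (form V) (u t) (timeDeriv u t) := by
  have hkinetic := integrable_norm_sq (timeDeriv u t)
  have hgradient := integrable_norm_sq (grad (u t))
  simp only [energy, ← Real.norm_eq_abs (timeDeriv u t _)]
  rw [integral_add (by exact hkinetic.add hgradient) (integrable_potential_mul_sq V _),
    integral_add hkinetic hgradient, integral_norm_sq, integral_norm_sq, phaseEnergy, form_self]
  ring

end Sobolev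

section Support

variable {n : ℕ} {f : L2 n}

lemma ae_eq_zero_of_essSupport_subset {F : Set (Space n)} (h : essSupport f ⊆ F) :
    ∀ᵐ x : Space n, x ∉ F → f x = 0 := by
  simp only [ae_iff, Classical.not_imp]
  refine measure_null_of_locally_null _ fun x hx => ?_
  have hxf : x ∉ essSupport f := fun hs => hx.1 (h hs)
  simp only [essSupport, mem_ofPred_eq, not_forall, not_not] at hxf
  obtain ⟨U, hU, hxU, hvanish⟩ := hxf
  refine ⟨U ∩ {y | y ∉ F ∧ f y ≠ 0}, Filter.inter_mem
    (mem_nhdsWithin_of_mem_nhds (hU.mem_nhds hxU)) self_mem_nhdsWithin, ?_⟩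
  refine measure_mono_null (fun y hy => ?_) (ae_iff.1 hvanish)
  exact fun himp => hy.2.2 (himp hy.1)

lemma ae_eq_zero_of_notMem {Ω : Set (Space n)} (hs : essSupport f ⊆ closure Ω)
    (hf : ∀ᵐ x : Space n, x ∈ frontier Ω → f x = 0) : ∀ᵐ x : Space n, x ∉ Ω → f x = 0 := by
  filter_upwards [ae_eq_zero_of_essSupport_subset hs, hf] with x houtside hfrontier hx
  by_cases hclosure : x ∈ closure Ω
  · exact hfrontier ⟨hclosure, fun hinterior => hx (interior_subset hinterior)⟩
  · exact houtside hclosure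

end Support

namespace IsWeakSolution

variable {n : ℕ} {V : Space n →ᵇ ℝ} {u₀ : H1 n} {u₁ : L2 n} {u : ℝ → H1 n} {t : ℝ}

lemma hasDerivAt_toL2 (h : IsWeakSolution V u₀ u₁ u) (ht : 0 < t) :
    HasDerivAt (fun s => toL2 (u s)) (timeDeriv u t) t :=
  ((h.contDiffOn.differentiableOn one_ne_zero) t ht.le).hasDerivWithinAt.hasDerivAt
    (Ici_mem_nhds ht)

lemma isDampedSolution (h : IsWeakSolution V u₀ u₁ u) :
    IsDampedSolution (toL2L n) (form V) (fun t => u (max t 0))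
      (fun t => timeDeriv u (max t 0)) := by
  have hmem : ∀ t : ℝ, max t 0 ∈ Ici (0 : ℝ) := fun t => le_max_right t 0
  have hmax : ∀ t : ℝ, 0 < t → (fun s => max s 0) =ᶠ[𝓝 t] id := fun t ht => by
    filter_upwards [Ioi_mem_nhds ht] with s hs using max_eq_left (le_of_lt hs)
  refine ⟨h.continuousOn.comp_continuous (by fun_prop) hmem,
    (h.contDiffOn.continuousOn_derivWithin (uniqueDiffOn_Ici 0) le_rfl).comp_continuous
      (by fun_prop) hmem, fun t ht => ?_, fun φ t ht => ?_⟩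
  · rw [max_eq_left ht.le]
    exact (h.hasDerivAt_toL2 ht).congr_of_eventuallyEq
      ((hmax t ht).fun_comp fun s => toL2 (u s))
  · rw [max_eq_left ht.le, form_apply]
    exact (h.equation φ t ht).congr_of_eventuallyEq
      ((hmax t ht).fun_comp fun s => inner ℝ (timeDeriv u s) (toL2 φ))

theorem decay (h : IsWeakSolution V u₀ u₁ u) (hV : ∀ x, 0 ≤ V x)
    (hzero : ∀ᵐ x : Space n, V x = 0 → (u₁ + toL2 u₀) x = 0)
    (hint : Integrable fun x => |(u₁ + toL2 u₀) x| ^ 2 / V x) (ht : 0 ≤ t) :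
    (1 + t) ^ 2 * energy V u t + (1 + t) * ‖toL2 (u t)‖ ^ 2 / 4
      ≤ 7 / 2 * ‖u₁‖ ^ 2 + 5 / 2 * form V u₀ u₀ + 5 / 2 * ‖toL2 u₀‖ ^ 2
        + (∫ x, |(u₁ + toL2 u₀) x| ^ 2 / V x) / 2 := by
  have hforcing : ∀ φ : H1 n, inner ℝ (timeDeriv u (max 0 0) + toL2L n (u (max 0 0))) (toL2L n φ)
      ≤ form V φ φ / 2 + (∫ x, |(u₁ + toL2 u₀) x| ^ 2 / V x) / 2 := by
    simpa only [max_self, h.initial, h.initial_deriv, toL2L_apply] using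
      inner_toL2_le hV hzero hint
  simpa only [max_self, max_eq_left ht, h.initial, h.initial_deriv, toL2L_apply,
    energy_eq_phaseEnergy] using
    h.isDampedSolution.decay (form_symm V) (form_self_nonneg hV) hforcing ht

end IsWeakSolution

end DampedWave

end

open DampedWave in
theorem theorem1p4_general {n : ℕ} {M : ℝ} {V : Space n →ᵇ ℝ} (hVM : ∀ x, V x ≤ M)
    (hV : ∀ x, 0 ≤ V x) {Ω : Set (Space n)} (hVΩ : ∀ x ∈ Ω, 0 < V x) {u₀ : H1 n} {u₁ : L2 n}
    (hoff : ∀ᵐ x : Space n, x ∉ Ω → (u₁ + toL2 u₀) x = 0)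
    (hint : IntegrableOn (fun x => |(u₁ + toL2 u₀) x| ^ 2 / V x) Ω) {u : ℝ → H1 n}
    (hu : IsWeakSolution V u₀ u₁ u) {t : ℝ} (ht : 0 ≤ t) :
    (1 + t) ^ 2 * energy V u t ≤ (14 + 10 * M) * (‖toL2 u₀‖ ^ 2 + ‖u₁‖ ^ 2 + ‖grad u₀‖ ^ 2
        + ∫ x in Ω, |(u₁ + toL2 u₀) x| ^ 2 / V x) ∧
      (1 + t) * ‖toL2 (u t)‖ ^ 2 ≤ (14 + 10 * M) * (‖toL2 u₀‖ ^ 2 + ‖u₁‖ ^ 2 + ‖grad u₀‖ ^ 2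
        + ∫ x in Ω, |(u₁ + toL2 u₀) x| ^ 2 / V x) := by
  have hzero : ∀ᵐ x : Space n, V x = 0 → (u₁ + toL2 u₀) x = 0 :=
    hoff.mono fun x hx hVx => hx fun hxΩ => (hVΩ x hxΩ).ne' hVx
  have hquotient : ∀ᵐ x : Space n, x ∉ Ω → |(u₁ + toL2 u₀) x| ^ 2 / V x = 0 :=
    hoff.mono fun x hx hxΩ => by
      rw [hx hxΩ, abs_zero, zero_pow two_ne_zero, zero_div]
  have hdecay := hu.decay hV hzero (hint.integrable_of_ae_notMem_eq_zero hquotient) ht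
  rw [← setIntegral_eq_integral_of_ae_compl_eq_zero hquotient] at hdecay
  have hform := form_self_le hVM u₀
  have hM : 0 ≤ M := (hV 0).trans (hVM 0)
  have hL : 0 ≤ ∫ x in Ω, |(u₁ + toL2 u₀) x| ^ 2 / V x :=
    integral_nonneg fun x => div_nonneg (sq_nonneg _) (hV x)
  have henergy : 0 ≤ (1 + t) ^ 2 * energy V u t := by
    have hpotential := form_self_nonneg hV (u t)
    rw [energy_eq_phaseEnergy, phaseEnergy]
    positivity
  have hnorm : 0 ≤ (1 + t) * ‖toL2 (u t)‖ ^ 2 := by positivity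
  have hbound : 4 * ((1 + t) ^ 2 * energy V u t) + (1 + t) * ‖toL2 (u t)‖ ^ 2
      ≤ (14 + 10 * M) * (‖toL2 u₀‖ ^ 2 + ‖u₁‖ ^ 2 + ‖grad u₀‖ ^ 2
        + ∫ x in Ω, |(u₁ + toL2 u₀) x| ^ 2 / V x) := by
    linarith [mul_nonneg hM (sq_nonneg ‖u₁‖), mul_nonneg hM (sq_nonneg ‖grad u₀‖),
      mul_nonneg hM hL, sq_nonneg ‖toL2 u₀‖, sq_nonneg ‖grad u₀‖]
  constructor <;> linarith

theorem theorem1p4 (M : ℝ) :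
    ∃ C : ℝ, 0 < C ∧
      ∀ (n : ℕ), 1 ≤ n →
      ∀ (Ω : Set (DampedWave.Space n)), IsOpen Ω →
      ∀ (V : DampedWave.Space n →ᵇ ℝ),
        (∀ x, V x ≤ M) → (∀ x, 0 ≤ V x) → (∀ x ∈ Ω, 0 < V x) →
      ∀ (u₀ : DampedWave.H1 n) (u₁ : DampedWave.L2 n),
        DampedWave.essSupport (u₁ + DampedWave.toL2 u₀) ⊆ closure Ω →
        (∀ᵐ x : DampedWave.Space n, x ∈ frontier Ω → (u₁ + DampedWave.toL2 u₀) x = 0) →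
        IntegrableOn (fun x => |(u₁ + DampedWave.toL2 u₀) x| ^ 2 / V x) Ω volume →
      ∀ (u : ℝ → DampedWave.H1 n), DampedWave.IsWeakSolution V u₀ u₁ u →
      ∀ t : ℝ, 0 ≤ t →
        (1 + t) ^ 2 * DampedWave.energy V u t ≤
            C * (‖DampedWave.toL2 u₀‖ ^ 2 + ‖u₁‖ ^ 2 + ‖DampedWave.grad u₀‖ ^ 2
              + ∫ x in Ω, |(u₁ + DampedWave.toL2 u₀) x| ^ 2 / V x) ∧
        (1 + t) * ‖DampedWave.toL2 (u t)‖ ^ 2 ≤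
            C * (‖DampedWave.toL2 u₀‖ ^ 2 + ‖u₁‖ ^ 2 + ‖DampedWave.grad u₀‖ ^ 2
              + ∫ x in Ω, |(u₁ + DampedWave.toL2 u₀) x| ^ 2 / V x) := by
  refine ⟨14 + 10 * |M|, by positivity, fun n _ Ω _ V hVM hV hVΩ u₀ u₁ hs hf hi u hu t ht => ?_⟩
  exact theorem1p4_general (fun x => (hVM x).trans (le_abs_self M)) hV hVΩ
    (DampedWave.ae_eq_zero_of_notMem hs hf) hi hu ht
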